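/- For $z\in\mathbb{C}$ and $n\ge 0$ put $(z,n)=z(z+1)\cdots(z+n-1)$, and let $$F(a,b,c;x)=\sum_{n\ge0}\frac{(a,n)(b,n)}{(c,n)(1,n)}x^n .$$ Outside the open unit disc $F$ is understood by analytic continuation, as follows. Fix $\theta\in(-\pi/2,\pi/2)$ and let $D_\theta=\mathbb{C}\setminus\{1+te^{i\theta}:t\ge0\}$ (so $D_0=\mathbb{C}\setminus[1,\infty)$, and every complex number other than $1$ lies in some $D_\theta$). On $D_\theta$, $F(a,b,c;\cdot)$ denotes the analytic continuation of the series from $|x|<1$, and $(1-x)^s$ denotes the analytic branch with value $1$ at $x=0$. When the series is a polynomial it is taken at every $x\in\mathbb{C}$, and $F(\ldots;1)$ denotes the sum of the series when it converges absolutely at $x=1$. We put $0^0=1$. **Theorem 1.1.** Let $\ell$ be a positive integer, $a\in\mathbb{C}$ and $c\in\mathbb{C}\setminus\mathbb{Z}$. Then $F(1-a,-\ell,2-c;x)$ is a polynomial in $x$ of degree at most $\ell$, and there is a polynomial $q_0$ of degree at most $\ell-1$, not depending on $\theta$, such that for all $\theta\in(-\pi/2,\pi/2)$ and all $x\in D_\theta$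 $$q_0(x)=-\frac{(1,\ell)}{1-c}(1-x)^{c-a-1}F(c-a,c-1-\ell,c;x)+\frac{(2-c,\ell)}{1-c}F(a,1,c;x)\,F(1-a,-\ell,2-c;x),$$ where the continuations involved exist on $D_\theta$. For every root $\lambda\ne1$ of $F(1-a,-\ell,2-c;x)$ and every $\theta\in(-\pi/2,\pi/2)$ with $\lambda\in D_\theta$, $$F(a,1+\ell,c;\lambda)=-\frac{(1-c)\,q_0(\lambda)}{(1,\ell)(1-\lambda)^\ell},$$ $$F(c-a,c-1-\ell,c;\lambda)=-\frac{1-c}{(1,\ell)}(1-\lambda)^{a+1-c}q_0(\lambda);$$ the second formula also holds at the root $\lambda=1$ when $c=a+1$. In particular, for $\ell=1$ and $a\ne1$, put $\lambda=\frac{c-2}{a-1}$, so that $1-\lambda=\frac{a+1-c}{a-1}$. If $\lambda\in D_\theta$, then $$F\Bigl(a,2,c;\frac{c-2}{a-1}\Bigr)=\frac{(a-1)(c-1)}{a+1-c},\qquad F\Bigl(c-a,c-2,c;\frac{c-2}{a-1}\Bigr)=(c-1)\Bigl(\frac{a+1-c}{a-1}\Bigr)^{a+1-c},$$ and the second formula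 also holds if $c=a+1$. Replacing $(a,c)$ by $(a+b+1,b+2)$, the latter is Gosper's identity $$F\Bigl(1-a,b,b+2;\frac{b}{a+b}\Bigr)=(b+1)\Bigl(\frac{a}{a+b}\Bigr)^a$$ for $a\in\mathbb{C}$, $b\in\mathbb{C}\setminus\mathbb{Z}$, $a+b\ne0$, where either $\frac{b}{a+b}\in D_\theta$ or $a=0$. In these last two formulas the powers on the right are those of $1-x$ at the argument $x$ of $F$ on the left, in the branch fixed above. -/

import Mathlib

open Polynomial

/-- The rising factorial `(z, n) = z (z + 1) ⋯ (z + n - 1)`. -/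
noncomputable def poch (z : ℂ) (n : ℕ) : ℂ := (ascPochhammer ℂ n).eval z

/-- The complex plane cut along the ray that leaves the point `1` in the direction `exp (θ i)`.
For `θ = 0` this is the usual domain `ℂ ∖ [1, ∞)`. For `|θ| < π / 2` the ray does not meet the open
unit disc, and every complex number other than `1` lies in such a domain. -/
def cutPlane (θ : ℝ) : Set ℂ :=
  {x : ℂ | ∀ t : ℝ, 0 ≤ t → x ≠ 1 + (t : ℂ) * Complex.exp ((θ : ℂ) * Complex.I)}

/-- `f` is analytic on the cut plane and extends the power series
`∑ (a, n) (b, n) / ((c, n) (1, n)) xⁿ` (which converges for `|x| < 1`) from the open unit disc. -/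
def IsHypContinuation (θ : ℝ) (a b c : ℂ) (f : ℂ → ℂ) : Prop :=
  AnalyticOnNhd ℂ f (cutPlane θ) ∧ ∀ x : ℂ, ‖x‖ < 1 → f x = ordinaryHypergeometric a b c x

open Classical in
/-- The Gauss hypergeometric function `F(a, b, c; x)`: on the plane cut in the direction `θ` it is
the analytic continuation of the hypergeometric series from the unit disc (unique, as the cut plane
is connected); on the cut itself it is the sum of the series (used only for a terminating series, or
at `x = 1` for an absolutely convergent one). -/
noncomputable def hypF (θ : ℝ) (a b c x : ℂ) : ℂ :=
  if h : x ∈ cutPlane θ ∧ ∃ f : ℂ → ℂ, IsHypContinuation θ a b c f then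
    Classical.choose h.2 x
  else ordinaryHypergeometric a b c x

/-- The branch of `z ^ s` that is analytic off the ray `{- t exp (θ i) : t ≥ 0}` and, for `|θ| < π`,
equals `1` at `z = 1`. Thus `cutPow θ (1 - x) s` is the branch of `(1 - x) ^ s` on `cutPlane θ` with
value `1` at `x = 0`; for `θ = 0` and `z ≠ 0` it is the principal power `z ^ s`. Also
`cutPow θ 0 0 = 1`. -/
noncomputable def cutPow (θ : ℝ) (z s : ℂ) : ℂ :=
  Complex.exp (s * (Complex.log (z * Complex.exp (-((θ : ℂ) * Complex.I)))
    + (θ : ℂ) * Complex.I))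

/-! The series `F(a, 1, c; x)` satisfies a first-order inhomogeneous equation. The raising operator
`x d/dx + b` builds `F(a, 1 + ℓ, c)` from it, and the equation removes every derivative on the way,
so that `ℓ! (1 - x)^ℓ F(a, 1 + ℓ, c) = A F(a, 1, c) + B` with polynomials `A`, `B`
(`factorial_mul_hypF_eq`). The recursion for `A` is the lowering relation for `F(1 - a, -ℓ, 2 - c)`,
so `A` is `(2 - c, ℓ)` times that polynomial (`eval_contiguousA`). At a root of `A` the
transcendental term disappears; `q₀` is `-B / (1 - c)`. Euler's transformation
(`isHypContinuation_euler`) turns this into the second evaluation.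

Continuation rests on the same equation (`exists_solution_on_cutPlane`): `u = log (1 - x)` maps the
cut plane into a convex strip in which the equation has `u = 0` as its only singular point. An
integrating factor reduces it to `u Y' + m Y = Q`, solved by an integral. Uniqueness of the analytic
solution at `0` identifies it with the series. The root `1`, which lies on the cut, is handled by a
telescoping sum (`hyp_one_left_apply_one`). -/

/-! ### First-order equations with a regular singular point at `0` -/

open Set Filter Topology in
/-- The Euler operator `u d/du + m` is surjective on holomorphic functions on an open set that is
star-shaped about `0`, if `Re m > 1`. -/
theorem exists_euler_eq_of_one_lt_re {S : Set ℂ} (hS : IsOpen S) (hst : StarConvex ℝ 0 S)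
    {Q : ℂ → ℂ} (hQ : DifferentiableOn ℂ Q S) {m : ℂ} (hm : 1 < m.re) :
    ∃ Y : ℂ → ℂ, DifferentiableOn ℂ Y S ∧ ∀ u ∈ S, u * deriv Y u + m * Y u = Q u := by
  have hmem : ∀ u ∈ S, ∀ s ∈ Icc (0 : ℝ) 1, (s : ℂ) * u ∈ S := fun u hu s hs => by
    simpa using hst.smul_mem hu hs.1 hs.2
  have hdQ : ∀ w ∈ S, HasDerivAt Q (deriv Q w) w := fun w hw =>
    (hQ.differentiableAt (hS.mem_nhds hw)).hasDerivAt
  have hQ' : ContinuousOn (deriv Q) S := (hQ.deriv hS).continuousOn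
  have c1 : Continuous fun s : ℝ => (s : ℂ) ^ (m - 1) :=
    Complex.continuous_ofReal_cpow_const (by simpa using hm)
  have c2 : Continuous fun s : ℝ => (s : ℂ) ^ m :=
    Complex.continuous_ofReal_cpow_const (by linarith)
  have cQ : ∀ u ∈ S, ContinuousOn (fun s : ℝ => Q ((s : ℂ) * u)) (Icc 0 1) := fun u hu =>
    hQ.continuousOn.comp (by fun_prop) (fun s hs => hmem u hu s hs)
  have cQ' : ∀ u ∈ S, ContinuousOn (fun s : ℝ => deriv Q ((s : ℂ) * u)) (Icc 0 1) := fun u hu =>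
    hQ'.comp (by fun_prop) (fun s hs => hmem u hu s hs)
  have i1 : ∀ u ∈ S, IntervalIntegrable (fun s : ℝ => (s : ℂ) ^ (m - 1) * Q (s * u))
      MeasureTheory.volume 0 1 := fun u hu =>
    (c1.continuousOn.mul (cQ u hu)).intervalIntegrable_of_Icc zero_le_one
  have i2 : ∀ u ∈ S, IntervalIntegrable (fun s : ℝ => (s : ℂ) ^ m * deriv Q (s * u))
      MeasureTheory.volume 0 1 := fun u hu =>
    (c2.continuousOn.mul (cQ' u hu)).intervalIntegrable_of_Icc zero_le_one
  -- The solution is `Y u = ∫₀¹ s^(m-1) Q(su) ds`, differentiated under the integral sign; `Re m >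
  -- 1` makes `s^(m-1)` continuous at `0`.
  have key : ∀ u ∈ S, HasDerivAt (fun u => ∫ s in (0 : ℝ)..1, (s : ℂ) ^ (m - 1) * Q (s * u))
      (∫ s in (0 : ℝ)..1, (s : ℂ) ^ m * deriv Q (s * u)) u := by
    intro u hu
    obtain ⟨ε, hε, hball⟩ := Metric.nhds_basis_closedBall.mem_iff.1 (hS.mem_nhds hu)
    have hK : IsCompact ((fun p : ℝ × ℂ => (p.1 : ℂ) * p.2) ''
        (Icc (0 : ℝ) 1 ×ˢ Metric.closedBall u ε)) :=
      (isCompact_Icc.prod (isCompact_closedBall u ε)).image (by fun_prop)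
    obtain ⟨C, hC⟩ := hK.exists_bound_of_continuousOn (hQ'.mono (by
      rintro _ ⟨⟨s, v⟩, ⟨hs, hv⟩, rfl⟩
      exact hmem v (hball hv) s hs))
    have h01 : uIoc (0 : ℝ) 1 = Ioc 0 1 := uIoc_of_le zero_le_one
    refine (intervalIntegral.hasDerivAt_integral_of_dominated_loc_of_deriv_le
      (F' := fun u s => (s : ℂ) ^ m * deriv Q (s * u)) (bound := fun _ => C)
      (Metric.closedBall_mem_nhds u hε) ?_ (i1 u hu) ?_ ?_ (by simp) ?_).2
    · filter_upwards [hS.mem_nhds hu] with v hv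
      simpa [h01] using (i1 v hv).1.aestronglyMeasurable
    · simpa [h01] using (i2 u hu).1.aestronglyMeasurable
    · refine Eventually.of_forall fun s hs v hv => ?_
      rw [h01] at hs
      have h1 : ‖(s : ℂ) ^ m‖ ≤ 1 := by
        rw [Complex.norm_cpow_eq_rpow_re_of_pos hs.1]
        exact Real.rpow_le_one hs.1.le hs.2 (by linarith)
      have h2 := hC _ ⟨(s, v), ⟨⟨hs.1.le, hs.2⟩, hv⟩, rfl⟩
      rw [norm_mul]
      calc _ ≤ 1 * C := mul_le_mul h1 h2 (norm_nonneg _) zero_le_one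
        _ = C := one_mul C
    · refine Eventually.of_forall fun s hs v hv => ?_
      rw [h01] at hs
      have h := ((hdQ _ (hmem v (hball hv) s ⟨hs.1.le, hs.2⟩)).comp v
        ((hasDerivAt_id v).const_mul (s : ℂ))).const_mul ((s : ℂ) ^ (m - 1))
      refine h.congr_deriv ?_
      have hs0 : (s : ℂ) ≠ 0 := by exact_mod_cast hs.1.ne'
      rw [Complex.cpow_sub _ _ hs0]
      simp only [Complex.cpow_one]
      field_simp
  refine ⟨fun u => ∫ s in (0 : ℝ)..1, (s : ℂ) ^ (m - 1) * Q (s * u),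
    fun u hu => (key u hu).differentiableAt.differentiableWithinAt, fun u hu => ?_⟩
  rw [(key u hu).deriv, ← intervalIntegral.integral_const_mul,
    ← intervalIntegral.integral_const_mul, ← intervalIntegral.integral_add
      ((i2 u hu).const_mul _) ((i1 u hu).const_mul _)]
  -- The combined integrand is the `s`-derivative of `s^m Q(su)`, so the integral is its value `Q u`
  -- at `s = 1`.
  rw [intervalIntegral.integral_eq_sub_of_hasDerivAt_of_le (f := fun s : ℝ => (s : ℂ) ^ m * Q (s * u))
    zero_le_one (c2.continuousOn.mul (cQ u hu)) ?_
      (((i2 u hu).const_mul _).add ((i1 u hu).const_mul _))]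
  · have : m ≠ 0 := by rintro rfl; norm_num at hm
    simp [this]
  · intro s hs
    have h1 : HasDerivAt (fun s : ℝ => (s : ℂ) ^ m) (m * (s : ℂ) ^ (m - 1)) s := by
      have := (hasDerivAt_id (s : ℂ)).cpow_const (c := m) (Or.inl (by simpa using hs.1))
      simpa using this.comp_ofReal
    have h2 : HasDerivAt (fun s : ℝ => Q (s * u)) (deriv Q (s * u) * u) s := by
      have := (hdQ _ (hmem u hu s ⟨hs.1.le, hs.2.le⟩)).comp (s : ℂ)
        ((hasDerivAt_id (s : ℂ)).mul_const u)
      simpa using this.comp_ofReal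
    refine (h1.mul h2).congr_deriv ?_
    ring

/-- The Euler operator `u d/du + m` is surjective on holomorphic functions on an open set that is
star-shaped about `0`, if `m ≠ 0, -1, -2, …`. -/
theorem exists_euler_eq {S : Set ℂ} (hS : IsOpen S) (hst : StarConvex ℝ 0 S) (h0 : (0 : ℂ) ∈ S)
    {Q : ℂ → ℂ} (hQ : DifferentiableOn ℂ Q S) {m : ℂ} (hm : ∀ n : ℕ, m + n ≠ 0) :
    ∃ Y : ℂ → ℂ, DifferentiableOn ℂ Y S ∧ ∀ u ∈ S, u * deriv Y u + m * Y u = Q u := by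
  obtain ⟨N, hN⟩ := exists_nat_gt (1 - m.re)
  induction N generalizing m Q with
  | zero => exact exists_euler_eq_of_one_lt_re hS hst hQ (by norm_num at hN; linarith)
  | succ N ih =>
    have hQ1 : DifferentiableOn ℂ (dslope Q 0) S :=
      (Complex.differentiableOn_dslope (hS.mem_nhds h0)).2 hQ
    obtain ⟨Y, hY, hYe⟩ := ih hQ1 (m := m + 1)
      (fun n => by have := hm (n + 1); push_cast at this; rwa [add_assoc, add_comm (1 : ℂ)])
      (by push_cast at hN; simp; linarith)
    -- Splitting off the constant term replaces `Q` by `(Q - Q 0) / u` and `m` by `m + 1`.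
    refine ⟨fun u => Q 0 / m + u * Y u, by fun_prop, fun u hu => ?_⟩
    have hd : HasDerivAt (fun u => Q 0 / m + u * Y u) (1 * Y u + u * deriv Y u) u :=
      ((hasDerivAt_id u).mul
        (hY.differentiableAt (hS.mem_nhds hu)).hasDerivAt).const_add _
    have hm0 : m ≠ 0 := by simpa using hm 0
    have h1 : u * dslope Q 0 u = Q u - Q 0 := by simpa using sub_smul_dslope Q 0 u
    rw [hd.deriv]
    have := hYe u hu
    field_simp
    linear_combination u * this + h1

/-- A first-order linear equation with a regular singular point at `0`, with exponent not a
natural number, has a solution which is holomorphic on a given convex neighbourhood of `0`. -/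
theorem exists_solution_of_regular_singular {S : Set ℂ} (hS : IsOpen S) (hc : Convex ℝ S)
    (h0 : (0 : ℂ) ∈ S) {p q : ℂ → ℂ} (hp : DifferentiableOn ℂ p S) (hq : DifferentiableOn ℂ q S)
    (hm : ∀ n : ℕ, p 0 + n ≠ 0) :
    ∃ f : ℂ → ℂ, DifferentiableOn ℂ f S ∧ ∀ u ∈ S, u * deriv f u + p u * f u = q u := by
  have hp1 : DifferentiableOn ℂ (dslope p 0) S :=
    (Complex.differentiableOn_dslope (hS.mem_nhds h0)).2 hp
  -- A primitive of `(p - p 0) / u`: the integrating factor `exp P` makes the coefficient the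
  -- constant `p 0`.
  obtain ⟨P, hP'⟩ := hc.exists_forall_hasDerivWithinAt hp1
  have hP : ∀ u ∈ S, HasDerivAt P (dslope p 0 u) u := fun u hu =>
    (hP' u hu).hasDerivAt (hS.mem_nhds hu)
  have hPd : DifferentiableOn ℂ P S := fun u hu => (hP u hu).differentiableAt.differentiableWithinAt
  obtain ⟨Y, hY, hYe⟩ := exists_euler_eq hS (hc.starConvex h0) h0
    (Q := fun u => Complex.exp (P u) * q u) (hPd.cexp.mul hq) hm
  refine ⟨fun u => Complex.exp (-P u) * Y u, hPd.neg.cexp.mul hY, fun u hu => ?_⟩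
  have hd := ((hP u hu).neg.cexp.mul (hY.differentiableAt (hS.mem_nhds hu)).hasDerivAt)
  have hd' : deriv (fun u => Complex.exp (-P u) * Y u) u = _ := hd.deriv
  rw [hd']
  have h1 : u * dslope p 0 u = p u - p 0 := by simpa using sub_smul_dslope p 0 u
  have h2 := hYe u hu
  have h3 : Complex.exp (-P u) * Complex.exp (P u) = 1 := by rw [← Complex.exp_add]; simp
  simp only [Pi.neg_apply]
  linear_combination (-Complex.exp (-P u) * Y u) * h1 + Complex.exp (-P u) * h2 + q u * h3

/-! ### The cut plane and the branch of the power -/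

/-- Rotating `1 - x` by `-θ` carries the cut to the negative real axis, where the principal
logarithm has its own cut. -/
theorem mem_cutPlane_iff {θ : ℝ} {x : ℂ} :
    x ∈ cutPlane θ ↔ (1 - x) * Complex.exp (-((θ : ℂ) * Complex.I)) ∈ Complex.slitPlane := by
  have h1 : Complex.exp ((θ : ℂ) * Complex.I) * Complex.exp (-((θ : ℂ) * Complex.I)) = 1 := by
    rw [← Complex.exp_add]; simp
  rw [Complex.mem_slitPlane_iff_not_le_zero, cutPlane, Set.mem_ofPred_eq]
  constructor
  · intro h hle
    obtain ⟨hre, him⟩ := Complex.le_def.1 hle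
    refine h (-((1 - x) * Complex.exp (-((θ : ℂ) * Complex.I))).re) (neg_nonneg.2 (by simpa only [Complex.zero_re] using hre)) ?_
    have h2 : (((((1 - x) * Complex.exp (-((θ : ℂ) * Complex.I))).re : ℝ) : ℂ)) =
        (1 - x) * Complex.exp (-((θ : ℂ) * Complex.I)) :=
      Complex.ext (by simp) (by simpa using him.symm)
    rw [Complex.ofReal_neg, h2]
    linear_combination (1 - x) * h1
  · rintro h t ht rfl
    apply h
    have : (1 - (1 + (t : ℂ) * Complex.exp (θ * Complex.I))) *
        Complex.exp (-((θ : ℂ) * Complex.I)) = ((-t : ℝ) : ℂ) := by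
      push_cast
      linear_combination (-(t : ℂ)) * h1
    rw [this]
    exact_mod_cast neg_nonpos.2 ht

theorem isOpen_cutPlane (θ : ℝ) : IsOpen (cutPlane θ) := by
  have : cutPlane θ = (fun x : ℂ => (1 - x) * Complex.exp (-((θ : ℂ) * Complex.I))) ⁻¹'
      Complex.slitPlane := Set.ext fun x => mem_cutPlane_iff
  rw [this]
  exact Complex.isOpen_slitPlane.preimage (by fun_prop)

theorem isPreconnected_cutPlane (θ : ℝ) : IsPreconnected (cutPlane θ) := by
  have h1 : Complex.exp ((θ : ℂ) * Complex.I) * Complex.exp (-((θ : ℂ) * Complex.I)) = 1 := by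
    rw [← Complex.exp_add]; simp
  have : cutPlane θ = (fun w : ℂ => 1 - w * Complex.exp ((θ : ℂ) * Complex.I)) ''
      Complex.slitPlane := by
    ext x
    rw [mem_cutPlane_iff]
    constructor
    · intro h
      exact ⟨_, h, by linear_combination (x - 1) * h1⟩
    · rintro ⟨w, hw, rfl⟩
      convert hw using 1
      linear_combination w * h1
  rw [this]
  exact (Complex.starConvex_one_slitPlane.isPathConnected (by simp)).isConnected.isPreconnected.image _
    (by fun_prop)

theorem ball_subset_cutPlane {θ : ℝ} (hθ : |θ| < Real.pi / 2) :
    Metric.ball (0 : ℂ) 1 ⊆ cutPlane θ := by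
  rintro x hx t ht rfl
  have hcos : 0 < Real.cos θ := Real.cos_pos_of_mem_Ioo (abs_lt.1 hθ)
  have h1 := (Complex.re_le_norm _).trans_lt (mem_ball_zero_iff.1 hx)
  have h2 : (1 + (t : ℂ) * Complex.exp ((θ : ℂ) * Complex.I)).re = 1 + t * Real.cos θ := by
    simp [Complex.exp_ofReal_mul_I_re]
  nlinarith [mul_nonneg ht hcos.le]

theorem zero_mem_cutPlane {θ : ℝ} (hθ : |θ| < Real.pi / 2) : (0 : ℂ) ∈ cutPlane θ :=
  ball_subset_cutPlane hθ (by simp)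

theorem ne_one_of_mem_cutPlane {θ : ℝ} {x : ℂ} (hx : x ∈ cutPlane θ) : x ≠ 1 := by
  simpa using hx 0 le_rfl

theorem one_notMem_cutPlane (θ : ℝ) : (1 : ℂ) ∉ cutPlane θ := fun h =>
  ne_one_of_mem_cutPlane h rfl

/-- The branch of the logarithm underlying `cutPow`. -/
noncomputable def cutLog (θ : ℝ) (z : ℂ) : ℂ :=
  Complex.log (z * Complex.exp (-((θ : ℂ) * Complex.I))) + (θ : ℂ) * Complex.I

theorem cutPow_eq (θ : ℝ) (z s : ℂ) : cutPow θ z s = Complex.exp (s * cutLog θ z) := rfl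

theorem exp_cutLog (θ : ℝ) {z : ℂ} (hz : z ≠ 0) : Complex.exp (cutLog θ z) = z := by
  rw [cutLog, Complex.exp_add, Complex.exp_log (mul_ne_zero hz (Complex.exp_ne_zero _)), mul_assoc,
    ← Complex.exp_add]
  simp

theorem cutLog_one {θ : ℝ} (hθ : |θ| < Real.pi / 2) : cutLog θ 1 = 0 := by
  have := abs_lt.1 hθ
  have hpi := Real.pi_pos
  rw [cutLog, one_mul, Complex.log_exp] <;> simp <;> linarith

/-- Places the image of the cut plane in the convex strip where the differential equation is solved.
-/
theorem abs_im_cutLog_sub_lt {θ : ℝ} {x : ℂ} (hx : x ∈ cutPlane θ) :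
    |(cutLog θ (1 - x)).im - θ| < Real.pi := by
  have h := Complex.mem_slitPlane_iff_arg.1 (mem_cutPlane_iff.1 hx)
  have h2 := Complex.arg_mem_Ioc ((1 - x) * Complex.exp (-((θ : ℂ) * Complex.I)))
  have h3 : (cutLog θ (1 - x)).im - θ =
      ((1 - x) * Complex.exp (-((θ : ℂ) * Complex.I))).arg := by
    simp [cutLog, Complex.log_im]
  rw [h3, abs_lt]
  exact ⟨h2.1, lt_of_le_of_ne h2.2 h.1⟩

theorem hasDerivAt_cutLog_one_sub {θ : ℝ} {x : ℂ} (hx : x ∈ cutPlane θ) :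
    HasDerivAt (fun x => cutLog θ (1 - x)) (-(1 - x)⁻¹) x := by
  have h0 : (1 : ℂ) - x ≠ 0 := sub_ne_zero.2 (ne_one_of_mem_cutPlane hx).symm
  have h := ((((hasDerivAt_id x).const_sub 1).mul_const
    (Complex.exp (-((θ : ℂ) * Complex.I)))).clog (mem_cutPlane_iff.1 hx)).add_const
      ((θ : ℂ) * Complex.I)
  refine h.congr_deriv ?_
  simp only [id]
  field_simp [Complex.exp_ne_zero]

theorem hasDerivAt_cutPow_one_sub {θ : ℝ} {x : ℂ} (hx : x ∈ cutPlane θ) (s : ℂ) :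
    HasDerivAt (fun x => cutPow θ (1 - x) s) (-s / (1 - x) * cutPow θ (1 - x) s) x := by
  refine (((hasDerivAt_cutLog_one_sub hx).const_mul s).cexp).congr_deriv ?_
  rw [cutPow_eq]
  ring

theorem analyticOnNhd_cutPow_one_sub (θ : ℝ) (s : ℂ) :
    AnalyticOnNhd ℂ (fun x => cutPow θ (1 - x) s) (cutPlane θ) :=
  DifferentiableOn.analyticOnNhd
    (fun _ hx => (hasDerivAt_cutPow_one_sub hx s).differentiableAt.differentiableWithinAt)
    (isOpen_cutPlane θ)

theorem cutPow_add (θ : ℝ) (z s t : ℂ) : cutPow θ z (s + t) = cutPow θ z s * cutPow θ z t := by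
  simp only [cutPow_eq, ← Complex.exp_add, add_mul]

theorem cutPow_natCast (θ : ℝ) {z : ℂ} (hz : z ≠ 0) (n : ℕ) : cutPow θ z n = z ^ n := by
  rw [cutPow_eq, Complex.exp_nat_mul, exp_cutLog θ hz]

theorem cutPow_one_right (θ : ℝ) {z : ℂ} (hz : z ≠ 0) : cutPow θ z 1 = z := by
  simpa using cutPow_natCast θ hz 1

theorem cutPow_add_one (θ : ℝ) {z : ℂ} (hz : z ≠ 0) (s : ℂ) :
    cutPow θ z (s + 1) = cutPow θ z s * z := by
  rw [cutPow_add, cutPow_one_right θ hz]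

theorem cutPow_zero_right (θ : ℝ) (z : ℂ) : cutPow θ z 0 = 1 := by
  simp [cutPow_eq]

theorem cutPow_one_left {θ : ℝ} (hθ : |θ| < Real.pi / 2) (s : ℂ) : cutPow θ 1 s = 1 := by
  simp [cutPow_eq, cutLog_one hθ]

/-! ### Uniqueness at the singular point, and a solution on the cut plane -/

open Filter Topology in
/-- A solution of `x d' + p d = 0` which is analytic and vanishes at `0` vanishes near `0`, if
`p 0` is not a negative integer. -/
theorem eventually_eq_zero_of_regular_singular {p d : ℂ → ℂ} (hd : AnalyticAt ℂ d 0)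
    (hp : ContinuousAt p 0) (hd0 : d 0 = 0) (hm : ∀ n : ℕ, n ≠ 0 → p 0 + n ≠ 0)
    (h : ∀ᶠ x in 𝓝 0, x * deriv d x + p x * d x = 0) : ∀ᶠ x in 𝓝 0, d x = 0 := by
  by_contra hne
  have htop : analyticOrderAt d 0 ≠ ⊤ := fun h => hne (analyticOrderAt_eq_top.1 h)
  obtain ⟨g, hg, hg0, hdg⟩ := hd.analyticOrderAt_ne_top.1 htop
  set n := analyticOrderNatAt d 0
  simp only [sub_zero, smul_eq_mul] at hdg
  have hn : n ≠ 0 := by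
    intro hn
    have := hdg.self_of_nhds
    rw [hn] at this
    simp [hd0] at this
    exact hg0 this.symm
  -- Inserting `d = x^n g` and cancelling `x^n`, then letting `x → 0`, gives `(n + p 0) g 0 = 0`,
  -- which is impossible.
  have h1 : ∀ᶠ x in 𝓝[≠] (0 : ℂ), n * g x + x * deriv g x + p x * g x = 0 := by
    have hgd : ∀ᶠ x in 𝓝 (0 : ℂ), AnalyticAt ℂ g x := hg.eventually_analyticAt
    filter_upwards [nhdsWithin_le_nhds h, nhdsWithin_le_nhds hgd,
      nhdsWithin_le_nhds hdg.eventually_nhds, self_mem_nhdsWithin] with x hx hgx hdx hx0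
    have hder : HasDerivAt d (n * x ^ (n - 1) * g x + x ^ n * deriv g x) x :=
      ((hasDerivAt_pow n x).mul hgx.differentiableAt.hasDerivAt).congr_of_eventuallyEq hdx
    rw [hder.deriv, hdx.self_of_nhds] at hx
    have hpow : x * x ^ (n - 1) = x ^ n := by rw [mul_comm, pow_sub_one_mul hn]
    refine (mul_eq_zero.1 (?_ : x ^ n * _ = 0)).resolve_left (pow_ne_zero n hx0)
    linear_combination hx - n * g x * hpow
  have h2 : ContinuousAt (fun x => n * g x + x * deriv g x + p x * g x) 0 := by
    have := hg.continuousAt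
    have := hg.deriv.continuousAt
    fun_prop
  have h3 : n * g 0 + 0 * deriv g 0 + p 0 * g 0 = 0 :=
    tendsto_nhds_unique (h2.tendsto.mono_left nhdsWithin_le_nhds)
      (tendsto_const_nhds.congr' (h1.mono fun x hx => hx.symm))
  refine mul_ne_zero (hm n hn) hg0 ?_
  linear_combination h3

/-- The equation satisfied by `F(a, 1, c; x)` has a solution which is analytic on the cut plane. -/
theorem exists_solution_on_cutPlane {θ : ℝ} (hθ : |θ| < Real.pi / 2) (a : ℂ) {c : ℂ}
    (hc : ∀ n : ℤ, c ≠ n) :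
    ∃ f : ℂ → ℂ, AnalyticOnNhd ℂ f (cutPlane θ) ∧ ∀ x ∈ cutPlane θ,
      x * (1 - x) * deriv f x + (c - 1 - a * x) * f x = c - 1 := by
  have habs := abs_lt.1 hθ
  have hpi := Real.pi_pos
  set S : Set ℂ := {u | |u.im - θ| < Real.pi} with hS
  have hSeq : S = Complex.im ⁻¹' Set.Ioo (θ - Real.pi) (θ + Real.pi) := by
    ext u
    simp only [hS, Set.mem_ofPred_eq, abs_lt, Set.mem_preimage, Set.mem_Ioo]
    constructor <;> rintro ⟨h1, h2⟩ <;> constructor <;> linarith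
  have hSo : IsOpen S := by
    rw [hSeq]; exact isOpen_Ioo.preimage Complex.continuous_im
  have hSc : Convex ℝ S := by
    rw [hSeq]; exact (convex_Ioo _ _).linear_preimage Complex.imLm
  have hS0 : (0 : ℂ) ∈ S := by
    simp only [hS, Set.mem_ofPred_eq, Complex.zero_im, abs_lt]; constructor <;> linarith
  -- With `x = 1 - exp u` the leading term `x (1 - x) d/dx` becomes `(exp u - 1) d/du = u χ(u)
  -- d/du`. The zeros of `χ` are the points `2πin` with `n ≠ 0`, all outside the strip since `|θ| <
  -- π / 2`.
  set χ : ℂ → ℂ := dslope Complex.exp 0 with hχ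
  have hχd : DifferentiableOn ℂ χ S := (Complex.differentiableOn_dslope (hSo.mem_nhds hS0)).2
    Complex.differentiable_exp.differentiableOn
  have hχ0 : χ 0 = 1 := by simp [hχ, dslope_same]
  have hχu : ∀ u, u * χ u = Complex.exp u - 1 := fun u => by
    simpa using sub_smul_dslope Complex.exp 0 u
  have hχne : ∀ u ∈ S, χ u ≠ 0 := by
    intro u hu h0
    have h1 : Complex.exp u = 1 := by
      have := hχu u
      rw [h0, mul_zero] at this
      exact (sub_eq_zero.1 this.symm)
    obtain ⟨n, rfl⟩ := Complex.exp_eq_one_iff.1 h1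
    have h2 : |2 * Real.pi * n - θ| < Real.pi := by
      simpa [hS, mul_comm, mul_assoc, mul_left_comm] using hu
    rw [abs_lt] at h2
    have h3 : (-1 : ℝ) < n := by
      by_contra hcon
      nlinarith
    have h4 : (n : ℝ) < 1 := by
      by_contra hcon
      nlinarith
    have h5 : n = 0 := by
      have h3' : (-1 : ℤ) < n := by exact_mod_cast h3
      have h4' : n < (1 : ℤ) := by exact_mod_cast h4
      omega
    rw [h5] at h0
    simp [hχ0] at h0
  obtain ⟨g, hg, hge⟩ := exists_solution_of_regular_singular hSo hSc hS0
    (p := fun u => (c - 1 - a * (1 - Complex.exp u)) / χ u) (q := fun u => (c - 1) / χ u)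
    (DifferentiableOn.div (by fun_prop) hχd hχne) (DifferentiableOn.div (by fun_prop) hχd hχne)
    (fun n hn => hc (1 - n) (by
      simp only [Complex.exp_zero, sub_self, mul_zero, sub_zero, hχ0, div_one] at hn
      push_cast
      linear_combination hn))
  have hd : ∀ x ∈ cutPlane θ, HasDerivAt (fun x => g (cutLog θ (1 - x)))
      (deriv g (cutLog θ (1 - x)) * -(1 - x)⁻¹) x := fun x hx =>
    ((hg.differentiableAt (hSo.mem_nhds (abs_im_cutLog_sub_lt hx))).hasDerivAt).comp x
      (hasDerivAt_cutLog_one_sub hx)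
  refine ⟨fun x => g (cutLog θ (1 - x)), DifferentiableOn.analyticOnNhd
    (fun x hx => (hd x hx).differentiableAt.differentiableWithinAt) (isOpen_cutPlane θ),
    fun x hx => ?_⟩
  have h0 : (1 : ℂ) - x ≠ 0 := sub_ne_zero.2 (ne_one_of_mem_cutPlane hx).symm
  have hu := abs_im_cutLog_sub_lt hx
  have h1 := hge _ hu
  have h2 := hχu (cutLog θ (1 - x))
  have h3 := hχne _ hu
  simp only [exp_cutLog θ h0] at h1 h2
  rw [(hd x hx).deriv]
  set u := cutLog θ (1 - x)
  field_simp at h1 ⊢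
  linear_combination h1 - deriv g u * h2

/-! ### The series in the unit disc and its contiguous relations -/

theorem hypCoeff_zero (a b c : ℂ) : ordinaryHypergeometricCoefficient a b c 0 = 1 := by
  simp [ordinaryHypergeometricCoefficient]

theorem hypCoeff_succ (a b : ℂ) {c : ℂ} {n : ℕ} (hc : c + n ≠ 0) :
    ordinaryHypergeometricCoefficient a b c (n + 1) =
      ordinaryHypergeometricCoefficient a b c n * ((a + n) * (b + n) / ((c + n) * (n + 1))) := by
  have hn : (n : ℂ) + 1 ≠ 0 := by exact_mod_cast n.succ_ne_zero
  have hf : (n.factorial : ℂ) ≠ 0 := by exact_mod_cast n.factorial_ne_zero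
  simp only [ordinaryHypergeometricCoefficient, ascPochhammer_succ_eval, Nat.factorial_succ,
    Nat.cast_mul, Nat.cast_add, Nat.cast_one, mul_inv]
  field_simp

theorem one_le_radius_hypSeries (a b : ℂ) {c : ℂ} (hc : ∀ n : ℕ, c + n ≠ 0) :
    1 ≤ (ordinaryHypergeometricSeries ℂ a b c).radius := by
  by_cases ha : ∃ k : ℕ, a = -(k : ℂ)
  · obtain ⟨k, rfl⟩ := ha
    rw [ordinaryHypergeometric_radius_top_of_neg_nat₁]
    exact le_top
  by_cases hb : ∃ k : ℕ, b = -(k : ℂ)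
  · obtain ⟨k, rfl⟩ := hb
    rw [ordinaryHypergeometric_radius_top_of_neg_nat₂]
    exact le_top
  rw [ordinaryHypergeometricSeries_radius_eq_one]
  push Not at ha hb
  exact fun k => ⟨fun h => ha k (by rw [h, neg_neg]), fun h => hb k (by rw [h, neg_neg]),
    fun h => hc k (by rw [h]; ring)⟩

theorem hasFPowerSeriesOnBall_hyp (a b : ℂ) {c : ℂ} (hc : ∀ n : ℕ, c + n ≠ 0) :
    HasFPowerSeriesOnBall (ordinaryHypergeometric a b c : ℂ → ℂ)
      (ordinaryHypergeometricSeries ℂ a b c) 0 1 :=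
  (FormalMultilinearSeries.hasFPowerSeriesOnBall _
    (one_pos.trans_le (one_le_radius_hypSeries a b hc))).mono one_pos
      (one_le_radius_hypSeries a b hc)

theorem analyticOnNhd_hyp (a b : ℂ) {c : ℂ} (hc : ∀ n : ℕ, c + n ≠ 0) :
    AnalyticOnNhd ℂ (ordinaryHypergeometric a b c : ℂ → ℂ) (Metric.ball 0 1) := by
  have := (hasFPowerSeriesOnBall_hyp a b hc).analyticOnNhd
  rwa [← Metric.eball_ofReal, ENNReal.ofReal_one]

theorem hasSum_hyp (a b : ℂ) {c x : ℂ} (hc : ∀ n : ℕ, c + n ≠ 0) (hx : ‖x‖ < 1) :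
    HasSum (fun n => ordinaryHypergeometricCoefficient a b c n * x ^ n)
      (ordinaryHypergeometric a b c x) := by
  have h := (hasFPowerSeriesOnBall_hyp a b hc).hasSum (y := x)
    (by rw [← ENNReal.ofReal_one, Metric.eball_ofReal]; simpa using hx)
  simpa only [ordinaryHypergeometricSeries_apply_eq, zero_add, smul_eq_mul] using h

theorem hasSum_shift {u : ℕ → ℂ} {s : ℂ} (h : HasSum u s) (x : ℂ) :
    HasSum (fun n => Nat.rec 0 (fun k _ => x * u k) n) (x * s) := by
  have := (hasSum_nat_add_iff (f := fun n => (Nat.rec 0 (fun k _ => x * u k) n : ℂ)) 1).1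
    (h.mul_left x)
  simpa using this

/-- Termwise application of `x d/dx` to the hypergeometric series. -/
theorem hasSum_mul_deriv_hyp (a b : ℂ) {c x : ℂ} (hc : ∀ n : ℕ, c + n ≠ 0) (hx : ‖x‖ < 1) :
    HasSum (fun n => n * (ordinaryHypergeometricCoefficient a b c n * x ^ n))
      (x * deriv (ordinaryHypergeometric a b c) x) := by
  have h := (hasFPowerSeriesOnBall_hyp a b hc).fderiv.hasSum (y := x)
    (by rw [← ENNReal.ofReal_one, Metric.eball_ofReal]; simpa using hx)
  have h2 := h.mapL (ContinuousLinearMap.apply ℂ ℂ x)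
  simp only [ContinuousLinearMap.apply_apply, FormalMultilinearSeries.derivSeries_apply_diag,
    ordinaryHypergeometricSeries_apply_eq, zero_add] at h2
  have h3 : HasSum (fun n : ℕ => ((n + 1 : ℕ) : ℂ) *
      (ordinaryHypergeometricCoefficient a b c (n + 1) * x ^ (n + 1)))
      (x * deriv (ordinaryHypergeometric a b c) x) := by
    have e : x * deriv (ordinaryHypergeometric a b c) x =
        fderiv ℂ (ordinaryHypergeometric a b c) x x := by
      rw [← fderiv_apply_one_eq_deriv, ← smul_eq_mul, ← map_smul, smul_eq_mul, mul_one]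
    rw [e]
    exact h2.congr_fun fun n => by simp only [nsmul_eq_mul, smul_eq_mul]
  simpa using (hasSum_nat_add_iff
    (f := fun n : ℕ => (n : ℂ) * (ordinaryHypergeometricCoefficient a b c n * x ^ n)) 1).1 h3

/-- For `b = 1` the factor `(1, n)` cancels and the coefficients obey `(c + n) u (n + 1) = (a + n) u
n`; the right-hand side is the constant term left over. -/
theorem hyp_ode_one (a : ℂ) {c x : ℂ} (hc : ∀ n : ℕ, c + n ≠ 0) (hx : ‖x‖ < 1) :
    x * (1 - x) * deriv (ordinaryHypergeometric a 1 c) x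
      + (c - 1 - a * x) * ordinaryHypergeometric a 1 c x = c - 1 := by
  have h1 := hasSum_hyp a 1 hc hx
  have h2 := hasSum_mul_deriv_hyp a 1 hc hx
  have h := ((h2.sub (hasSum_shift h2 x)).add (h1.mul_left (c - 1))).sub
    ((hasSum_shift h1 x).mul_left a)
  have h' : HasSum (fun n : ℕ => if n = 0 then c - 1 else 0) (c - 1) := hasSum_ite_eq 0 (c - 1)
  have := h.unique (h'.congr_fun ?_)
  · linear_combination this
  · rintro (_ | n)
    · simp [hypCoeff_zero]
    · have hn : (n : ℂ) + 1 ≠ 0 := by exact_mod_cast n.succ_ne_zero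
      have := hc n
      simp only [hypCoeff_succ a 1 (hc n), n.succ_ne_zero, if_false]
      push_cast
      field_simp
      ring

/-- Termwise this is `b (b + 1, n) = (b + n) (b, n)`. -/
theorem hyp_contiguous_raise (a b : ℂ) {c x : ℂ} (hc : ∀ n : ℕ, c + n ≠ 0) (hx : ‖x‖ < 1) :
    b * ordinaryHypergeometric a (b + 1) c x =
      x * deriv (ordinaryHypergeometric a b c) x + b * ordinaryHypergeometric a b c x := by
  refine ((hasSum_hyp a (b + 1) hc hx).mul_left b).unique
    (((hasSum_mul_deriv_hyp a b hc hx).add ((hasSum_hyp a b hc hx).mul_left b)).congr_fun ?_)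
  intro n
  have h : b * ordinaryHypergeometricCoefficient a (b + 1) c n =
      (b + n) * ordinaryHypergeometricCoefficient a b c n := by
    induction n with
    | zero => simp [hypCoeff_zero]
    | succ n ih =>
      have hn : (n : ℂ) + 1 ≠ 0 := by exact_mod_cast n.succ_ne_zero
      have := hc n
      rw [hypCoeff_succ _ _ (hc n), hypCoeff_succ _ _ (hc n), ← mul_assoc, ih]
      push_cast
      field_simp
      ring
  linear_combination x ^ n * h

/-- Termwise this rests on `(b - 1, n + 1) = (b - 1) (b, n)`. It drives both Euler's transformation
and the recursion for `contiguousA`. -/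
theorem hyp_contiguous_lower (a b : ℂ) {c x : ℂ} (hc : ∀ n : ℕ, c + n ≠ 0) (hx : ‖x‖ < 1) :
    (c - b) * ordinaryHypergeometric a (b - 1) c x =
      x * (1 - x) * deriv (ordinaryHypergeometric a b c) x
        + (c - b - a * x) * ordinaryHypergeometric a b c x := by
  have h1 := hasSum_hyp a b hc hx
  have h2 := hasSum_mul_deriv_hyp a b hc hx
  have h := ((h2.sub (hasSum_shift h2 x)).add (h1.mul_left (c - b))).sub
    ((hasSum_shift h1 x).mul_left a)
  have h' := (((hasSum_hyp a (b - 1) hc hx).mul_left (c - b)))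
  have := h.unique (h'.congr_fun ?_)
  · linear_combination -this
  · rintro (_ | n)
    · simp [hypCoeff_zero]
    · have hn : (n : ℂ) + 1 ≠ 0 := by exact_mod_cast n.succ_ne_zero
      have := hc n
      have h : ordinaryHypergeometricCoefficient a (b - 1) c (n + 1) =
          ordinaryHypergeometricCoefficient a b c n *
            ((a + n) * (b - 1) / ((c + n) * (n + 1))) := by
        clear hn this
        induction n with
        | zero => simp [hypCoeff_succ _ _ (hc 0), hypCoeff_zero]
        | succ n ih =>
          have hn : (n : ℂ) + 1 ≠ 0 := by exact_mod_cast n.succ_ne_zero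
          have hn2 : (n : ℂ) + 1 + 1 ≠ 0 := by exact_mod_cast (n + 1).succ_ne_zero
          have := hc n
          have := hc (n + 1)
          rw [hypCoeff_succ _ _ (hc (n + 1)), ih, hypCoeff_succ _ _ (hc n)]
          push_cast at *
          field_simp
          ring
      simp only [h, hypCoeff_succ a b (hc n)]
      push_cast
      field_simp
      ring

/-- At `b = c` the left side of the lowering relation vanishes. -/
theorem hyp_zero_right_eq_deriv (A : ℂ) {c x : ℂ} (hc : ∀ n : ℕ, c + n ≠ 0) (hx : ‖x‖ < 1) :
    x * (1 - x) * deriv (ordinaryHypergeometric A c c) x =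
      A * x * ordinaryHypergeometric A c c x := by
  have h := hyp_contiguous_lower A c hc hx
  linear_combination -h

/-! ### Continuation to the cut plane and Euler's transformation -/

theorem add_natCast_ne_zero_of_forall_ne_intCast {c : ℂ} (hc : ∀ n : ℤ, c ≠ n) (n : ℕ) :
    c + n ≠ 0 := fun h => hc (-n) (by push_cast; linear_combination h)

theorem IsHypContinuation.congr {θ : ℝ} {a b c : ℂ} {f g : ℂ → ℂ} (hθ : |θ| < Real.pi / 2)
    (hf : IsHypContinuation θ a b c f) (h : Set.EqOn f g (cutPlane θ)) :
    IsHypContinuation θ a b c g :=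
  ⟨hf.1.congr (isOpen_cutPlane θ) h, fun x hx => by
    rw [← h (ball_subset_cutPlane hθ (by simpa using hx)), hf.2 x hx]⟩

open Filter Topology in
theorem IsHypContinuation.eqOn {θ : ℝ} {a b c : ℂ} {f g : ℂ → ℂ} (hθ : |θ| < Real.pi / 2)
    (hf : IsHypContinuation θ a b c f) (hg : IsHypContinuation θ a b c g) :
    Set.EqOn f g (cutPlane θ) := by
  refine hf.1.eqOn_of_preconnected_of_eventuallyEq hg.1 (isPreconnected_cutPlane θ)
    (zero_mem_cutPlane hθ) ?_
  filter_upwards [Metric.ball_mem_nhds (0 : ℂ) one_pos] with x hx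
  rw [hf.2 x (by simpa using hx), hg.2 x (by simpa using hx)]

theorem IsHypContinuation.eqOn_hypF {θ : ℝ} {a b c : ℂ} {f : ℂ → ℂ} (hθ : |θ| < Real.pi / 2)
    (hf : IsHypContinuation θ a b c f) : Set.EqOn f (hypF θ a b c) (cutPlane θ) := by
  intro x hx
  have h : x ∈ cutPlane θ ∧ ∃ f : ℂ → ℂ, IsHypContinuation θ a b c f := ⟨hx, f, hf⟩
  rw [hypF, dif_pos h]
  exact hf.eqOn hθ (Classical.choose_spec h.2) hx

theorem IsHypContinuation.hypF {θ : ℝ} {a b c : ℂ} {f : ℂ → ℂ} (hθ : |θ| < Real.pi / 2)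
    (hf : IsHypContinuation θ a b c f) : IsHypContinuation θ a b c (hypF θ a b c) :=
  hf.congr hθ (hf.eqOn_hypF hθ)

theorem hypF_of_notMem {θ : ℝ} {a b c x : ℂ} (hx : x ∉ cutPlane θ) :
    hypF θ a b c x = ordinaryHypergeometric a b c x := by
  rw [hypF, dif_neg fun h => hx h.1]

open Filter Topology in
theorem isHypContinuation_of_eventuallyEq {θ : ℝ} {a b c : ℂ} {f : ℂ → ℂ}
    (hθ : |θ| < Real.pi / 2) (hc : ∀ n : ℕ, c + n ≠ 0) (hf : AnalyticOnNhd ℂ f (cutPlane θ))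
    (h : f =ᶠ[𝓝 0] ordinaryHypergeometric a b c) : IsHypContinuation θ a b c f :=
  ⟨hf, fun _ hx => (hf.mono (ball_subset_cutPlane hθ)).eqOn_of_preconnected_of_eventuallyEq
    (analyticOnNhd_hyp a b hc) (convex_ball _ _).isPreconnected
    (Metric.mem_ball_self one_pos) h (by simpa using hx)⟩

theorem IsHypContinuation.deriv_eq {θ : ℝ} {a b c x : ℂ} {f : ℂ → ℂ}
    (hf : IsHypContinuation θ a b c f) (hx : ‖x‖ < 1) :
    deriv f x = deriv (ordinaryHypergeometric a b c) x :=
  Filter.EventuallyEq.deriv_eq (by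
    filter_upwards [Metric.isOpen_ball.mem_nhds (mem_ball_zero_iff.2 hx)] with y hy
    exact hf.2 y (by simpa using hy))

theorem IsHypContinuation.raise {θ : ℝ} {a b c : ℂ} {f : ℂ → ℂ} (hc : ∀ n : ℕ, c + n ≠ 0)
    (hb : b ≠ 0) (hf : IsHypContinuation θ a b c f) :
    IsHypContinuation θ a (b + 1) c (fun x => (x * deriv f x + b * f x) / b) := by
  refine ⟨?_, fun x hx => ?_⟩
  · exact ((analyticOnNhd_id.mul hf.1.deriv).add (analyticOnNhd_const.mul hf.1)).div
      analyticOnNhd_const fun _ _ => hb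
  · beta_reduce
    rw [hf.deriv_eq hx, hf.2 x hx, ← hyp_contiguous_raise a b hc hx, mul_div_cancel_left₀ _ hb]

theorem IsHypContinuation.lower {θ : ℝ} {a b c : ℂ} {f : ℂ → ℂ} (hc : ∀ n : ℕ, c + n ≠ 0)
    (hb : c - b ≠ 0) (hf : IsHypContinuation θ a b c f) :
    IsHypContinuation θ a (b - 1) c
      (fun x => (x * (1 - x) * deriv f x + (c - b - a * x) * f x) / (c - b)) := by
  refine ⟨?_, fun x hx => ?_⟩
  · exact (((analyticOnNhd_id.mul (analyticOnNhd_const.sub analyticOnNhd_id)).mul hf.1.deriv).add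
      ((analyticOnNhd_const.sub (analyticOnNhd_const.mul analyticOnNhd_id)).mul hf.1)).div
      analyticOnNhd_const fun _ _ => hb
  · beta_reduce
    rw [hf.deriv_eq hx, hf.2 x hx, ← hyp_contiguous_lower a b hc hx, mul_div_cancel_left₀ _ hb]

open Filter Topology in
theorem isHypContinuation_hypF_one {θ : ℝ} (hθ : |θ| < Real.pi / 2) (a : ℂ) {c : ℂ}
    (hc : ∀ n : ℤ, c ≠ n) :
    IsHypContinuation θ a 1 c (hypF θ a 1 c) ∧ ∀ x ∈ cutPlane θ,
      x * (1 - x) * deriv (hypF θ a 1 c) x + (c - 1 - a * x) * hypF θ a 1 c x = c - 1 := by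
  have hcn := add_natCast_ne_zero_of_forall_ne_intCast hc
  obtain ⟨f, hf, hfe⟩ := exists_solution_on_cutPlane hθ a hc
  have hc1 : c - 1 ≠ 0 := fun h => hc 1 (by push_cast; linear_combination h)
  have hF := analyticOnNhd_hyp a 1 hcn 0 (by simp)
  have h0 := hf 0 (zero_mem_cutPlane hθ)
  have hcont : IsHypContinuation θ a 1 c f := by
    refine isHypContinuation_of_eventuallyEq hθ hcn hf ?_
    -- The equation at `x = 0` forces `f 0 = 1`, and the exponent `c - 1` is not an integer, so `f`
    -- and the series agree near `0`.
    have := eventually_eq_zero_of_regular_singular (p := fun x => (c - 1 - a * x) / (1 - x))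
      (h0.sub hF) (ContinuousAt.div (by fun_prop) (by fun_prop) (by simp)) (by
        have := hfe 0 (zero_mem_cutPlane hθ)
        simp only [zero_mul, mul_zero, sub_zero, zero_add] at this
        simp only [Pi.sub_apply, ordinaryHypergeometric_zero]
        rw [mul_eq_left₀ hc1] at this
        rw [this, sub_self]) (fun n hn h => by
        refine hc (1 - n) ?_
        simp only [mul_zero, sub_zero, div_one] at h
        push_cast
        linear_combination h) (by
        filter_upwards [Metric.ball_mem_nhds (0 : ℂ) one_pos] with x hx
        have hx' := ball_subset_cutPlane hθ hx
        have h1 : (1 : ℂ) - x ≠ 0 := sub_ne_zero.2 (ne_one_of_mem_cutPlane hx').symm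
        have h2 := hyp_ode_one a hcn (mem_ball_zero_iff.1 hx)
        have h3 := hfe x hx'
        have h4 : deriv (f - ordinaryHypergeometric a 1 c) x = _ :=
          deriv_sub (hf x hx').differentiableAt (analyticOnNhd_hyp a 1 hcn x hx).differentiableAt
        rw [h4, Pi.sub_apply]
        field_simp
        linear_combination h3 - h2)
    filter_upwards [this] with x hx
    exact sub_eq_zero.1 hx
  refine ⟨hcont.hypF hθ, fun x hx => ?_⟩
  have h1 := hcont.eqOn_hypF hθ
  have h2 : deriv f x = deriv (hypF θ a 1 c) x :=
    (h1.eventuallyEq_of_mem ((isOpen_cutPlane θ).mem_nhds hx)).deriv_eq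
  rw [← h1 hx, ← h2]
  exact hfe x hx

theorem hypF_raise {θ : ℝ} (hθ : |θ| < Real.pi / 2) {a b c : ℂ} (hc : ∀ n : ℕ, c + n ≠ 0)
    (hb : b ≠ 0) (h : IsHypContinuation θ a b c (hypF θ a b c)) :
    IsHypContinuation θ a (b + 1) c (hypF θ a (b + 1) c) ∧ ∀ x ∈ cutPlane θ,
      b * hypF θ a (b + 1) c x = x * deriv (hypF θ a b c) x + b * hypF θ a b c x := by
  have h1 := h.raise hc hb
  refine ⟨h1.hypF hθ, fun x hx => ?_⟩
  rw [← h1.eqOn_hypF hθ hx, mul_div_cancel₀ _ hb]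

theorem isHypContinuation_hypF_one_add {θ : ℝ} (hθ : |θ| < Real.pi / 2) (a : ℂ) {c : ℂ}
    (hc : ∀ n : ℤ, c ≠ n) (j : ℕ) :
    IsHypContinuation θ a (1 + j) c (hypF θ a (1 + j) c) := by
  induction j with
  | zero => simpa using (isHypContinuation_hypF_one hθ a hc).1
  | succ j ih =>
    have := (hypF_raise hθ (add_natCast_ne_zero_of_forall_ne_intCast hc)
      (by rw [add_comm]; exact_mod_cast j.succ_ne_zero) ih).1
    rwa [add_assoc, ← Nat.cast_add_one] at this

open Filter Topology in
/-- The binomial series. -/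
theorem hyp_zero_right_eventuallyEq_cutPow {θ : ℝ} (hθ : |θ| < Real.pi / 2) (A : ℂ) {c : ℂ}
    (hc : ∀ n : ℕ, c + n ≠ 0) :
    (fun x => cutPow θ (1 - x) (-A)) =ᶠ[𝓝 0] ordinaryHypergeometric A c c := by
  have hF := analyticOnNhd_hyp A c hc
  have hT := analyticOnNhd_cutPow_one_sub θ (-A)
  have := eventually_eq_zero_of_regular_singular (p := fun x => -(A * x) / (1 - x))
    (d := (fun x => cutPow θ (1 - x) (-A)) - ordinaryHypergeometric A c c)
    ((hT 0 (zero_mem_cutPlane hθ)).sub (hF 0 (by simp)))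
    (ContinuousAt.div (by fun_prop) (by fun_prop) (by simp))
    (by simp [cutPow_one_left hθ]) (fun n hn h => hn (by simpa using h)) (by
      filter_upwards [Metric.ball_mem_nhds (0 : ℂ) one_pos] with x hx
      have hx' := ball_subset_cutPlane hθ hx
      have h1 : (1 : ℂ) - x ≠ 0 := sub_ne_zero.2 (ne_one_of_mem_cutPlane hx').symm
      have h2 := hyp_zero_right_eq_deriv A hc (mem_ball_zero_iff.1 hx)
      have h3 := hasDerivAt_cutPow_one_sub hx' (-A)
      rw [(h3.sub (hF x hx).differentiableAt.hasDerivAt).deriv, Pi.sub_apply]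
      field_simp
      linear_combination -h2)
  filter_upwards [this] with x hx
  exact sub_eq_zero.1 hx

open Filter Topology in
/-- Euler's transformation between `F(a, 1 + j, c)` and `F(c - a, c - 1 - j, c)`. -/
theorem isHypContinuation_euler {θ : ℝ} (hθ : |θ| < Real.pi / 2) (a : ℂ) {c : ℂ}
    (hc : ∀ n : ℤ, c ≠ n) (j : ℕ) :
    IsHypContinuation θ (c - a) (c - 1 - j) c
      (fun x => cutPow θ (1 - x) (a + 1 + j - c) * hypF θ a (1 + j) c x) := by
  have hcn := add_natCast_ne_zero_of_forall_ne_intCast hc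
  induction j with
  | zero =>
    obtain ⟨hf, hfe⟩ := isHypContinuation_hypF_one hθ a hc
    simp only [Nat.cast_zero, add_zero, sub_zero]
    have hd : ∀ x ∈ cutPlane θ, HasDerivAt
        (fun x => cutPow θ (1 - x) (a + 1 - c) * hypF θ a 1 c x) _ x := fun x hx =>
      (hasDerivAt_cutPow_one_sub hx (a + 1 - c)).mul (hf.1 x hx).differentiableAt.hasDerivAt
    have hg : AnalyticOnNhd ℂ (fun x => cutPow θ (1 - x) (a + 1 - c) * hypF θ a 1 c x)
      (cutPlane θ) := (analyticOnNhd_cutPow_one_sub θ _).mul hf.1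
    have hF := analyticOnNhd_hyp (c - a) (c - 1) hcn
    refine isHypContinuation_of_eventuallyEq hθ hcn hg ?_
    -- Under `x d/dx + (c - 1)` both functions go to `(c - 1) (1 - x)^(a - c)`: the product by its
    -- equation, the series because raising `c - 1` to `c` gives a binomial series.
    have := eventually_eq_zero_of_regular_singular (p := fun _ => c - 1)
      (d := (fun x => cutPow θ (1 - x) (a + 1 - c) * hypF θ a 1 c x)
        - ordinaryHypergeometric (c - a) (c - 1) c)
      ((hg 0 (zero_mem_cutPlane hθ)).sub (hF 0 (by simp))) continuousAt_const
      (by simp [cutPow_one_left hθ, hf.2 0 (by simp)]) (fun n hn h => by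
        refine hc (1 - n) ?_
        push_cast
        linear_combination h) (by
        filter_upwards [Metric.ball_mem_nhds (0 : ℂ) one_pos,
          hyp_zero_right_eventuallyEq_cutPow hθ (c - a) hcn] with x hx hB
        have hx' := ball_subset_cutPlane hθ hx
        have h1 : (1 : ℂ) - x ≠ 0 := sub_ne_zero.2 (ne_one_of_mem_cutPlane hx').symm
        have h2 := hyp_contiguous_raise (c - a) (c - 1) hcn (mem_ball_zero_iff.1 hx)
        rw [sub_add_cancel, ← hB] at h2
        have h3 := hfe x hx'
        have h4 : cutPow θ (1 - x) (a + 1 - c) = cutPow θ (1 - x) (-(c - a)) * (1 - x) := by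
          rw [← cutPow_add_one θ h1]
          ring_nf
        rw [((hd x hx').sub (hF x hx).differentiableAt.hasDerivAt).deriv, Pi.sub_apply, h4]
        field_simp
        linear_combination cutPow θ (1 - x) (-(c - a)) * h3 + h2)
    filter_upwards [this] with x hx
    exact sub_eq_zero.1 hx
  | succ j ih =>
    have hj : (1 : ℂ) + j ≠ 0 := by rw [add_comm]; exact_mod_cast j.succ_ne_zero
    have hf := isHypContinuation_hypF_one_add hθ a hc j
    -- Conjugation by the power turns this lowering operator into `1 - x` times the raising operator
    -- for `F(a, 1 + j, c)`.
    have h1 := ih.lower hcn (by rwa [show c - (c - 1 - j) = 1 + j by ring])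
    have e : c - 1 - ((j + 1 : ℕ) : ℂ) = c - 1 - j - 1 := by push_cast; ring
    rw [e]
    refine h1.congr hθ fun x hx => ?_
    have h0 : (1 : ℂ) - x ≠ 0 := sub_ne_zero.2 (ne_one_of_mem_cutPlane hx).symm
    have h2 := (hypF_raise hθ hcn hj hf).2 x hx
    have e2 : (1 : ℂ) + ((j + 1 : ℕ) : ℂ) = 1 + j + 1 := by push_cast; ring
    have e3 : cutPow θ (1 - x) (a + 1 + ((j + 1 : ℕ) : ℂ) - c) =
        cutPow θ (1 - x) (a + 1 + j - c) * (1 - x) := by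
      rw [← cutPow_add_one θ h0]
      push_cast
      ring_nf
    have hd := (hasDerivAt_cutPow_one_sub hx (a + 1 + j - c)).mul
      (hf.1 x hx).differentiableAt.hasDerivAt
    have hd' : deriv (fun x => cutPow θ (1 - x) (a + 1 + j - c) * hypF θ a (1 + j) c x) x = _ :=
      hd.deriv
    have e4 : c - (c - 1 - (j : ℂ)) = 1 + j := by ring
    simp only [e2, e3, e4]
    rw [hd', div_eq_iff hj]
    field_simp
    linear_combination (-(1 - x) * cutPow θ (1 - x) (a + 1 + j - c)) * h2

/-! ### The contiguity polynomials -/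

/-- The coefficient of `F(a, 1, c; x)` in `j! (1 - x) ^ j F(a, 1 + j, c; x)`. -/
noncomputable def contiguousA (a c : ℂ) : ℕ → ℂ[X]
  | 0 => 1
  | j + 1 => X * (1 - X) * derivative (contiguousA a c j)
      + (C (2 - c + j) - C (1 - a) * X) * contiguousA a c j

/-- The polynomial part of `j! (1 - x) ^ j F(a, 1 + j, c; x)`. -/
noncomputable def contiguousB (a c : ℂ) : ℕ → ℂ[X]
  | 0 => 0
  | j + 1 => X * (1 - X) * derivative (contiguousB a c j)
      + (C ((j : ℂ) + 1) - X) * contiguousB a c j + C (c - 1) * contiguousA a c j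

theorem natDegree_X_mul_one_sub_X_mul_derivative_le {p : ℂ[X]} {n : ℕ} (h : p.natDegree ≤ n) :
    (X * (1 - X) * derivative p).natDegree ≤ n + 1 := by
  rcases Nat.eq_zero_or_pos p.natDegree with h0 | h0
  · simp [derivative_of_natDegree_zero h0]
  · have h1 : (X * (1 - X) : ℂ[X]).natDegree ≤ 2 := by compute_degree
    have h2 := natDegree_derivative_le p
    have h3 := natDegree_mul_le (p := (X * (1 - X) : ℂ[X])) (q := derivative p)
    omega

theorem natDegree_contiguousA_le (a c : ℂ) (j : ℕ) : (contiguousA a c j).natDegree ≤ j := by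
  induction j with
  | zero => simp [contiguousA]
  | succ j ih =>
    refine natDegree_add_le_of_degree_le (natDegree_X_mul_one_sub_X_mul_derivative_le ih) ?_
    have h1 : (C (2 - c + j) - C (1 - a) * X : ℂ[X]).natDegree ≤ 1 := by compute_degree
    have h3 := natDegree_mul_le (p := (C (2 - c + j) - C (1 - a) * X : ℂ[X]))
      (q := contiguousA a c j)
    omega

theorem natDegree_contiguousB_le (a c : ℂ) (j : ℕ) :
    (contiguousB a c (j + 1)).natDegree ≤ j := by
  have hA : ∀ j, (C (c - 1) * contiguousA a c j).natDegree ≤ j := fun j =>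
    (natDegree_C_mul_le _ _).trans (natDegree_contiguousA_le a c j)
  induction j with
  | zero =>
    have h : contiguousB a c (0 + 1) = C (c - 1) := by simp [contiguousB, contiguousA]
    rw [h, natDegree_C]
  | succ j ih =>
    rw [contiguousB]
    refine natDegree_add_le_of_degree_le (natDegree_add_le_of_degree_le
      (natDegree_X_mul_one_sub_X_mul_derivative_le ih) ?_) (hA _)
    have h1 : (C (((j + 1 : ℕ) : ℂ) + 1) - X : ℂ[X]).natDegree ≤ 1 := by compute_degree
    have h3 := natDegree_mul_le (p := (C (((j + 1 : ℕ) : ℂ) + 1) - X : ℂ[X]))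
      (q := contiguousB a c (j + 1))
    omega

/-- At `1` the derivative term drops out, and for `c = a + 1` the remaining factor is `j`, which
vanishes at the first step. -/
theorem eval_contiguousA_succ_one (a : ℂ) (j : ℕ) :
    (contiguousA a (a + 1) (j + 1)).eval 1 = 0 := by
  induction j with
  | zero => simp [contiguousA]; ring
  | succ j ih => rw [contiguousA]; simp [ih]

theorem eval_contiguousB_succ_one (a : ℂ) (j : ℕ) :
    (contiguousB a (a + 1) (j + 1)).eval 1 = j.factorial * a := by
  induction j with
  | zero => simp [contiguousA, contiguousB]
  | succ j ih =>
    rw [contiguousB]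
    simp [ih, eval_contiguousA_succ_one, Nat.factorial_succ]
    ring

theorem poch_one (n : ℕ) : poch 1 n = n.factorial := by
  simp [poch, ascPochhammer_eval_one]

theorem poch_ne_zero {z : ℂ} (hz : ∀ n : ℕ, z + n ≠ 0) (n : ℕ) : poch z n ≠ 0 := by
  rw [poch, Ne, ascPochhammer_eval_eq_zero_iff]
  rintro ⟨k, -, h⟩
  exact hz k (by rw [h]; ring)

theorem forall_two_sub_ne_intCast {c : ℂ} (hc : ∀ n : ℤ, c ≠ n) (n : ℤ) : 2 - c ≠ n :=
  fun h => hc (2 - n) (by push_cast; linear_combination -h)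

/-- The recursion is the lowering relation with parameters `1 - a`, `-j`, `2 - c`. This gives
equality on the disc, and both sides are entire. -/
theorem eval_contiguousA (a : ℂ) {c : ℂ} (hc : ∀ n : ℤ, c ≠ n) (j : ℕ) (x : ℂ) :
    (contiguousA a c j).eval x =
      poch (2 - c) j * ordinaryHypergeometric (1 - a) (-(j : ℂ)) (2 - c) x := by
  have hcn := add_natCast_ne_zero_of_forall_ne_intCast (forall_two_sub_ne_intCast hc)
  have hball : ∀ x ∈ Metric.ball (0 : ℂ) 1, (contiguousA a c j).eval x =
      poch (2 - c) j * ordinaryHypergeometric (1 - a) (-(j : ℂ)) (2 - c) x := by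
    induction j with
    | zero =>
      intro x hx
      have h := hasSum_hyp (1 - a) (-((0 : ℕ) : ℂ)) hcn (mem_ball_zero_iff.1 hx)
      have h2 := h.unique ((hasSum_ite_eq 0 (1 : ℂ)).congr_fun fun n => ?_)
      · rw [h2]
        simp [contiguousA, poch]
      · rcases n with _ | n
        · simp [hypCoeff_zero]
        · simp [ascPochhammer_succ_left]
    | succ j ih =>
      intro x hx
      have h := hyp_contiguous_lower (1 - a) (-(j : ℂ)) hcn (mem_ball_zero_iff.1 hx)
      have hd : (derivative (contiguousA a c j)).eval x =
          poch (2 - c) j * deriv (ordinaryHypergeometric (1 - a) (-(j : ℂ)) (2 - c)) x := by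
        rw [← Polynomial.deriv, ← deriv_const_mul _
          (analyticOnNhd_hyp _ _ hcn x hx).differentiableAt]
        refine Filter.EventuallyEq.deriv_eq ?_
        filter_upwards [Metric.isOpen_ball.mem_nhds hx] with y hy using ih y hy
      have hp : poch (2 - c) (j + 1) = poch (2 - c) j * (2 - c + j) := by
        simp [poch, ascPochhammer_succ_eval]
      rw [contiguousA, hp, show -((j + 1 : ℕ) : ℂ) = -(j : ℂ) - 1 by push_cast; ring]
      simp only [eval_add, eval_mul, eval_sub, eval_X, eval_one, eval_C, hd, ih x hx]
      linear_combination -poch (2 - c) j * h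
  have hF : AnalyticOnNhd ℂ (fun x => poch (2 - c) j *
      (ordinaryHypergeometric (1 - a) (-(j : ℂ)) (2 - c) x : ℂ)) Set.univ := by
    refine analyticOnNhd_const.mul ?_
    have h := FormalMultilinearSeries.hasFPowerSeriesOnBall
      (ordinaryHypergeometricSeries ℂ (1 - a) (-(j : ℂ)) (2 - c))
      (by rw [ordinaryHypergeometric_radius_top_of_neg_nat₂]; exact ENNReal.zero_lt_top)
    have h2 := h.analyticOnNhd
    rw [ordinaryHypergeometric_radius_top_of_neg_nat₂, Metric.eball_top] at h2
    exact h2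
  have hA : AnalyticOnNhd ℂ (fun x => (contiguousA a c j).eval x) Set.univ :=
    (contiguousA a c j).differentiable.differentiableOn.analyticOnNhd isOpen_univ
  exact hA.eqOn_of_preconnected_of_eventuallyEq hF isPreconnected_univ (Set.mem_univ 0)
    (by filter_upwards [Metric.ball_mem_nhds (0 : ℂ) one_pos] with x hx using hball x hx)
    (Set.mem_univ x)

theorem poch_mul_hypF_eq_eval_contiguousA {θ : ℝ} (hθ : |θ| < Real.pi / 2) (a : ℂ) {c : ℂ}
    (hc : ∀ n : ℤ, c ≠ n) (j : ℕ) (x : ℂ) :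
    poch (2 - c) j * hypF θ (1 - a) (-(j : ℂ)) (2 - c) x = (contiguousA a c j).eval x := by
  have hcn := add_natCast_ne_zero_of_forall_ne_intCast (forall_two_sub_ne_intCast hc)
  have hp := poch_ne_zero hcn j
  by_cases hx : x ∈ cutPlane θ
  · have : IsHypContinuation θ (1 - a) (-(j : ℂ)) (2 - c)
        (fun x => (C (poch (2 - c) j)⁻¹ * contiguousA a c j).eval x) := by
      refine ⟨(Polynomial.differentiable _).differentiableOn.analyticOnNhd (isOpen_cutPlane θ),
        fun x _ => ?_⟩
      beta_reduce
      rw [eval_mul, eval_C, eval_contiguousA a hc, inv_mul_cancel_left₀ hp]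
    rw [← this.eqOn_hypF hθ hx]
    beta_reduce
    rw [eval_mul, eval_C, mul_inv_cancel_left₀ hp]
  · rw [hypF_of_notMem hx, eval_contiguousA a hc]

/-- Apply `x (1 - x) d/dx` to the identity for `j`: the raising relation rewrites the left side, and
the equation for `F(a, 1, c)` eliminates its derivative on the right. -/
theorem factorial_mul_hypF_eq {θ : ℝ} (hθ : |θ| < Real.pi / 2) (a : ℂ) {c : ℂ}
    (hc : ∀ n : ℤ, c ≠ n) (j : ℕ) {x : ℂ} (hx : x ∈ cutPlane θ) :
    j.factorial * (1 - x) ^ j * hypF θ a (1 + j) c x =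
      (contiguousA a c j).eval x * hypF θ a 1 c x + (contiguousB a c j).eval x := by
  obtain ⟨hf, hfe⟩ := isHypContinuation_hypF_one hθ a hc
  have hcn := add_natCast_ne_zero_of_forall_ne_intCast hc
  induction j generalizing x with
  | zero => simp [contiguousA, contiguousB]
  | succ j ih =>
    have hj : (1 : ℂ) + j ≠ 0 := by rw [add_comm]; exact_mod_cast j.succ_ne_zero
    have hfj := isHypContinuation_hypF_one_add hθ a hc j
    have h1 := (hypF_raise hθ hcn hj hfj).2 x hx
    have hl := (((((hasDerivAt_id x).const_sub 1).pow j).const_mul (j.factorial : ℂ)).mul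
      (hfj.1 x hx).differentiableAt.hasDerivAt)
    have hr := (((contiguousA a c j).hasDerivAt x).mul
      (hf.1 x hx).differentiableAt.hasDerivAt).add ((contiguousB a c j).hasDerivAt x)
    have hd := hl.unique (hr.congr_of_eventuallyEq (by
      filter_upwards [(isOpen_cutPlane θ).mem_nhds hx] with y hy using ih hy))
    have hpow : (j : ℂ) * ((1 - x) ^ (j - 1) * (1 - x)) = j * (1 - x) ^ j := by
      rcases j with _ | j <;> simp [pow_succ]
    have h2 := hfe x hx
    have h3 := ih hx
    rw [show (1 : ℂ) + ((j + 1 : ℕ) : ℂ) = 1 + j + 1 by push_cast; ring, contiguousA, contiguousB,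
      Nat.factorial_succ]
    simp only [eval_add, eval_mul, eval_sub, eval_X, eval_one, eval_C, id, Pi.pow_apply] at hd ⊢
    push_cast
    linear_combination j.factorial * (1 - x) ^ (j + 1) * h1 + x * (1 - x) * hd
      + (contiguousA a c j).eval x * h2 + (j + 1 - x) * h3
      + x * j.factorial * hypF θ a (1 + j) c x * hpow

/-! ### The value at `x = 1` -/

open Filter Topology Asymptotics in
theorem isBigO_inv_poch (b : ℂ) (m : ℕ) :
    (fun n : ℕ => (poch (b + n) m)⁻¹) =O[atTop] fun n : ℕ => ((n : ℝ)⁻¹) ^ m := by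
  induction m with
  | zero => simpa [poch] using isBigO_refl (fun _ : ℕ => (1 : ℝ)) atTop
  | succ m ih =>
    have h : (fun n : ℕ => (b + n + m)⁻¹) =O[atTop] fun n : ℕ => (n : ℝ)⁻¹ := by
      obtain ⟨N, hN⟩ := exists_nat_gt (2 * ‖b + m‖)
      refine IsBigO.of_bound 2 ?_
      filter_upwards [eventually_ge_atTop N, eventually_gt_atTop 0] with n hn hn0
      have hn' : (N : ℝ) ≤ n := by exact_mod_cast hn
      have hn0' : (0 : ℝ) < n := by exact_mod_cast hn0
      have h1 : (n : ℝ) - ‖b + m‖ ≤ ‖b + n + m‖ := by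
        have := norm_sub_norm_le (n : ℂ) (-(b + m))
        rw [norm_neg, Complex.norm_natCast] at this
        rwa [show (n : ℂ) - -(b + m) = b + n + m by ring] at this
      have h2 : (n : ℝ) / 2 ≤ ‖b + n + m‖ := by linarith
      rw [norm_inv, norm_inv, Real.norm_of_nonneg hn0'.le]
      calc ‖b + n + m‖⁻¹ ≤ ((n : ℝ) / 2)⁻¹ := inv_anti₀ (by positivity) h2
        _ = 2 * (n : ℝ)⁻¹ := by rw [inv_div]; ring
    refine (ih.mul h).congr (fun n => ?_) (fun n => ?_)
    · simp [poch, ascPochhammer_succ_eval, mul_comm]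
    · rw [pow_succ]

theorem poch_succ_left (z : ℂ) (n : ℕ) : poch z (n + 1) = z * poch (z + 1) n := by
  simp [poch, ascPochhammer_succ_left]

theorem poch_succ_right (z : ℂ) (n : ℕ) : poch z (n + 1) = poch z n * (z + n) := by
  simp [poch, ascPochhammer_succ_eval]

open Filter Topology Asymptotics in
/-- Gauss's summation of `F(1, c - 1 - ℓ, c; 1)`, where the partial sums telescope. -/
theorem hyp_one_left_apply_one {c : ℂ} (hc : ∀ n : ℤ, c ≠ n) {ℓ : ℕ} (hℓ : 0 < ℓ) :
    ordinaryHypergeometric 1 (c - 1 - ℓ) c (1 : ℂ) = (c - 1) / ℓ := by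
  have hcn := add_natCast_ne_zero_of_forall_ne_intCast hc
  have hc1 : ∀ n : ℕ, c - 1 + n ≠ 0 := fun n h => hc (1 - n) (by
    push_cast; linear_combination h)
  have hb : ∀ n : ℕ, c - 1 - ℓ + n ≠ 0 := fun n h => hc (1 + ℓ - n) (by
    push_cast; linear_combination h)
  have hℓ0 : (ℓ : ℂ) ≠ 0 := by exact_mod_cast hℓ.ne'
  have hc10 : c - 1 ≠ 0 := by simpa using hc1 0
  set b := c - 1 - ℓ with hbdef
  set u := ordinaryHypergeometricCoefficient 1 b c
  -- Lowering `c` to `c - 1` provides the telescoping sequence: `u n = (c - 1) / ℓ * (t n - t (n +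
  -- 1))`.
  set t := ordinaryHypergeometricCoefficient 1 b (c - 1)
  have hsucc : ∀ n : ℕ, (n : ℂ) + 1 ≠ 0 := fun n => by exact_mod_cast n.succ_ne_zero
  have hut : ∀ n, u n = (c - 1) * t n * (c - 1 + n)⁻¹ := by
    intro n
    induction n with
    | zero => simp [u, t, hypCoeff_zero, hc10]
    | succ n ih =>
      have e1 := hypCoeff_succ 1 b (hcn n)
      have e2 := hypCoeff_succ 1 b (hc1 n)
      change u (n + 1) = u n * _ at e1
      change t (n + 1) = t n * _ at e2
      rw [e1, e2, ih]
      have := hcn n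
      have := hc1 n
      have := hc1 (n + 1)
      have := hsucc n
      push_cast at *
      have h5 : c - 1 + ((n : ℂ) + 1) = c + n := by ring
      rw [h5] at *
      field_simp
  -- Since `b + ℓ = c - 1`, the quotient `(b, n) / (c - 1, n)` has a fixed number `ℓ` of factors,
  -- whence `t n = O(1 / n)`.
  have ht : ∀ n, t n = poch b ℓ * (poch (b + n) ℓ)⁻¹ := by
    have hpn : ∀ n : ℕ, poch (b + n) ℓ ≠ 0 := fun n => poch_ne_zero (fun k => by
      have := hb (n + k)
      push_cast at this
      rwa [add_assoc]) ℓ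
    intro n
    rw [eq_mul_inv_iff_mul_eq₀ (hpn n)]
    induction n with
    | zero => simp [t, hypCoeff_zero]
    | succ n ih =>
      have e2 := hypCoeff_succ 1 b (hc1 n)
      change t (n + 1) = t n * _ at e2
      have h1 : (b + n) * poch (b + (n + 1 : ℕ)) ℓ = poch (b + n) ℓ * (c - 1 + n) := by
        rw [show b + ((n + 1 : ℕ) : ℂ) = b + n + 1 by push_cast; ring, ← poch_succ_left,
          poch_succ_right, hbdef]
        ring
      have := hc1 n
      have := hsucc n
      rw [e2, ← ih]
      field_simp
      linear_combination t n * (n + 1) * h1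
  have htO : t =O[atTop] fun n : ℕ => ((n : ℝ)⁻¹) ^ 1 := by
    have h1 : t =O[atTop] fun n : ℕ => ((n : ℝ)⁻¹) ^ ℓ :=
      ((isBigO_inv_poch b ℓ).const_mul_left (poch b ℓ)).congr_left fun n => (ht n).symm
    refine h1.trans (IsBigO.of_bound 1 ?_)
    filter_upwards [eventually_gt_atTop 0] with n hn
    have hn1 : (1 : ℝ) ≤ n := by exact_mod_cast hn
    rw [one_mul, norm_pow, norm_pow]
    refine pow_le_pow_of_le_one (norm_nonneg _) ?_ hℓ
    rw [norm_inv, Real.norm_of_nonneg (by positivity)]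
    exact inv_le_one_of_one_le₀ hn1
  have ht0 : Tendsto t atTop (𝓝 0) := by
    refine htO.trans_tendsto ?_
    simpa using tendsto_inv_atTop_nhds_zero_nat (𝕜 := ℝ)
  have hsum : Summable u := by
    have h1 := (htO.const_mul_left (c - 1)).mul (isBigO_inv_poch (c - 1) 1)
    refine summable_of_isBigO_nat (g := fun n : ℕ => ((n : ℝ)⁻¹) ^ 2)
      (by simp [Real.summable_nat_pow_inv]) (h1.congr (fun n => ?_) (fun n => ?_))
    · simp [hut, poch]
    · ring
  have htel : ∀ n, u n = (c - 1) / ℓ * (t n - t (n + 1)) := by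
    intro n
    have e2 := hypCoeff_succ 1 b (hc1 n)
    change t (n + 1) = t n * _ at e2
    rw [e2, hut]
    have := hc1 n
    have := hsucc n
    field_simp
    rw [hbdef]
    ring
  have hS : HasSum u ((c - 1) / ℓ) := by
    rw [hsum.hasSum_iff_tendsto_nat]
    have h1 : ∀ N, ∑ n ∈ Finset.range N, u n = (c - 1) / ℓ * (t 0 - t N) := fun N => by
      simp only [htel]
      rw [← Finset.mul_sum, Finset.sum_range_sub']
    simp only [h1]
    have h2 : t 0 = 1 := hypCoeff_zero _ _ _
    simpa [h2] using (ht0.const_sub (t 0)).const_mul ((c - 1) / (ℓ : ℂ))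
  rw [ordinaryHypergeometric_eq_tsum]
  simp only [one_pow, smul_eq_mul, mul_one]
  exact hS.tsum_eq

/-! ### Evaluation at the roots -/

theorem hypF_euler {θ : ℝ} (hθ : |θ| < Real.pi / 2) (a : ℂ) {c : ℂ} (hc : ∀ n : ℤ, c ≠ n)
    (j : ℕ) {x : ℂ} (hx : x ∈ cutPlane θ) :
    hypF θ (c - a) (c - 1 - j) c x =
      cutPow θ (1 - x) (a + 1 - c) * ((1 - x) ^ j * hypF θ a (1 + j) c x) := by
  have hz : (1 : ℂ) - x ≠ 0 := sub_ne_zero.2 (ne_one_of_mem_cutPlane hx).symm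
  rw [← (isHypContinuation_euler hθ a hc j).eqOn_hypF hθ hx, ← cutPow_natCast θ hz, ← mul_assoc,
    ← cutPow_add]
  ring_nf

theorem hypF_eq_of_root {θ : ℝ} (hθ : |θ| < Real.pi / 2) (a : ℂ) {c : ℂ} (hc : ∀ n : ℤ, c ≠ n)
    (j : ℕ) {r : ℂ} (hr : (contiguousA a c j).eval r = 0) (hrm : r ∈ cutPlane θ) :
    hypF θ a (1 + j) c r = (contiguousB a c j).eval r / (j.factorial * (1 - r) ^ j) := by
  have hz : (1 : ℂ) - r ≠ 0 := sub_ne_zero.2 (ne_one_of_mem_cutPlane hrm).symm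
  have hj : (j.factorial : ℂ) ≠ 0 := by exact_mod_cast j.factorial_ne_zero
  have h := factorial_mul_hypF_eq hθ a hc j hrm
  rw [hr, zero_mul, zero_add] at h
  rw [eq_div_iff (mul_ne_zero hj (pow_ne_zero _ hz)), ← h]
  ring

theorem hypF_euler_eq_of_root {θ : ℝ} (hθ : |θ| < Real.pi / 2) (a : ℂ) {c : ℂ}
    (hc : ∀ n : ℤ, c ≠ n) {j : ℕ} (hj : 0 < j) {r : ℂ} (hr : (contiguousA a c j).eval r = 0)
    (hrm : r ∈ cutPlane θ ∨ (r = 1 ∧ c = a + 1)) :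
    hypF θ (c - a) (c - 1 - j) c r =
      cutPow θ (1 - r) (a + 1 - c) * ((contiguousB a c j).eval r / j.factorial) := by
  have hjf : (j.factorial : ℂ) ≠ 0 := by exact_mod_cast j.factorial_ne_zero
  rcases hrm with hrm | ⟨rfl, rfl⟩
  · have hz : (1 : ℂ) - r ≠ 0 := sub_ne_zero.2 (ne_one_of_mem_cutPlane hrm).symm
    rw [hypF_euler hθ a hc j hrm, hypF_eq_of_root hθ a hc j hr hrm]
    field_simp
  -- Off the cut plane `hypF` is the series, here with value `a / j`; this equals `B(1) / j!` as
  -- `B(1) = (j - 1)! a`.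
  · rw [hypF_of_notMem (one_notMem_cutPlane θ), add_sub_cancel_left a 1,
      hyp_one_left_apply_one hc hj, sub_self, sub_self, cutPow_zero_right]
    obtain ⟨k, rfl⟩ := Nat.exists_eq_succ_of_ne_zero hj.ne'
    have hk : (k.factorial : ℂ) ≠ 0 := by exact_mod_cast k.factorial_ne_zero
    have hk1 : (k : ℂ) + 1 ≠ 0 := by exact_mod_cast k.succ_ne_zero
    rw [Nat.succ_eq_add_one, eval_contiguousB_succ_one, Nat.factorial_succ]
    push_cast
    field_simp
    ring

theorem hypF_two_eq {θ : ℝ} (hθ : |θ| < Real.pi / 2) {a c : ℂ} (hc : ∀ n : ℤ, c ≠ n)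
    (ha : a ≠ 1) :
    ((c - 2) / (a - 1) ∈ cutPlane θ →
      hypF θ a 2 c ((c - 2) / (a - 1)) = (a - 1) * (c - 1) / (a + 1 - c)) ∧
    (((c - 2) / (a - 1) ∈ cutPlane θ ∨ c = a + 1) →
      hypF θ (c - a) (c - 2) c ((c - 2) / (a - 1))
        = (c - 1) * cutPow θ ((a + 1 - c) / (a - 1)) (a + 1 - c)) := by
  have ha' : a - 1 ≠ 0 := sub_ne_zero.2 ha
  -- For `ℓ = 1` the polynomials are `A = 2 - c - (1 - a) x` and `B = c - 1`.
  have hr : (contiguousA a c 1).eval ((c - 2) / (a - 1)) = 0 := by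
    simp [contiguousA]
    field_simp
    ring
  have hB : ∀ x, (contiguousB a c 1).eval x = c - 1 := fun x => by simp [contiguousA, contiguousB]
  have h1r : 1 - (c - 2) / (a - 1) = (a + 1 - c) / (a - 1) := by field_simp; ring
  refine ⟨fun h => ?_, fun h => ?_⟩
  · have := hypF_eq_of_root hθ a hc 1 hr h
    rw [hB, h1r, show (1 : ℂ) + ((1 : ℕ) : ℂ) = 2 by norm_num] at this
    rw [this, Nat.factorial_one, Nat.cast_one, one_mul, pow_one, div_div_eq_mul_div, mul_comm]
  · have := hypF_euler_eq_of_root hθ a hc one_pos hr (h.imp_right fun h => ⟨by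
      rw [h, div_eq_one_iff_eq ha']; ring, h⟩)
    rw [hB, h1r, show c - 1 - ((1 : ℕ) : ℂ) = c - 2 by push_cast; ring] at this
    rw [this]
    simp [mul_comm]

theorem theorem1p1 :
    -- the general evaluations
    (∀ (ℓ : ℕ) (a c : ℂ), 0 < ℓ → (∀ n : ℤ, c ≠ (n : ℂ)) →
      -- `F(1 - a, -ℓ, 2 - c; x)` is a polynomial of degree at most `ℓ`
      (∃ p : ℂ[X], p.natDegree ≤ ℓ ∧
        ∀ θ : ℝ, |θ| < Real.pi / 2 → ∀ x : ℂ,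
          hypF θ (1 - a) (-(ℓ : ℂ)) (2 - c) x = p.eval x) ∧
      ∃ q₀ : ℂ[X], q₀.natDegree ≤ ℓ - 1 ∧
        ∀ θ : ℝ, |θ| < Real.pi / 2 →
          -- the non-terminating series involved do continue analytically
          IsHypContinuation θ a 1 c (hypF θ a 1 c) ∧
          IsHypContinuation θ a (1 + (ℓ : ℂ)) c (hypF θ a (1 + (ℓ : ℂ)) c) ∧
          IsHypContinuation θ (c - a) (c - 1 - (ℓ : ℂ)) c (hypF θ (c - a) (c - 1 - (ℓ : ℂ)) c) ∧
          -- the formula for `q₀`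
          (∀ x ∈ cutPlane θ,
            q₀.eval x =
              -(poch 1 ℓ / (1 - c)) * cutPow θ (1 - x) (c - a - 1)
                  * hypF θ (c - a) (c - 1 - (ℓ : ℂ)) c x
                + poch (2 - c) ℓ / (1 - c) * hypF θ a 1 c x
                  * hypF θ (1 - a) (-(ℓ : ℂ)) (2 - c) x) ∧
          -- the evaluations at the roots
          ∀ r : ℂ, hypF θ (1 - a) (-(ℓ : ℂ)) (2 - c) r = 0 →
            (r ∈ cutPlane θ →
              hypF θ a (1 + (ℓ : ℂ)) c r
                = -((1 - c) * q₀.eval r / (poch 1 ℓ * (1 - r) ^ ℓ))) ∧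
            ((r ∈ cutPlane θ ∨ (r = 1 ∧ c = a + 1)) →
              hypF θ (c - a) (c - 1 - (ℓ : ℂ)) c r
                = -((1 - c) / poch 1 ℓ) * cutPow θ (1 - r) (a + 1 - c) * q₀.eval r)) ∧
    -- the case `ℓ = 1`
    (∀ (a c : ℂ) (θ : ℝ), (∀ n : ℤ, c ≠ (n : ℂ)) → a ≠ 1 → |θ| < Real.pi / 2 →
      ((c - 2) / (a - 1) ∈ cutPlane θ →
        hypF θ a 2 c ((c - 2) / (a - 1)) = (a - 1) * (c - 1) / (a + 1 - c)) ∧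
      (((c - 2) / (a - 1) ∈ cutPlane θ ∨ c = a + 1) →
        hypF θ (c - a) (c - 2) c ((c - 2) / (a - 1))
          = (c - 1) * cutPow θ ((a + 1 - c) / (a - 1)) (a + 1 - c))) ∧
    -- Gosper's identity
    (∀ (a b : ℂ) (θ : ℝ), (∀ n : ℤ, b ≠ (n : ℂ)) → a + b ≠ 0 → |θ| < Real.pi / 2 →
      (b / (a + b) ∈ cutPlane θ ∨ a = 0) →
      hypF θ (1 - a) b (b + 2) (b / (a + b)) = (b + 1) * cutPow θ (a / (a + b)) a) := by
  refine ⟨fun ℓ a c hℓ hc => ?_, fun a c θ hc ha hθ => hypF_two_eq hθ hc ha, ?_⟩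
  · have hcn := add_natCast_ne_zero_of_forall_ne_intCast (forall_two_sub_ne_intCast hc)
    have hp := poch_ne_zero hcn ℓ
    have hc1 : 1 - c ≠ 0 := fun h => hc 1 (by push_cast; linear_combination -h)
    have hf : poch 1 ℓ = ℓ.factorial := poch_one ℓ
    have hf0 : (ℓ.factorial : ℂ) ≠ 0 := by exact_mod_cast ℓ.factorial_ne_zero
    refine ⟨⟨C (poch (2 - c) ℓ)⁻¹ * contiguousA a c ℓ,
      (natDegree_C_mul_le _ _).trans (natDegree_contiguousA_le a c ℓ), fun θ hθ x => ?_⟩,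
      C (-(1 - c)⁻¹) * contiguousB a c ℓ, ?_, fun θ hθ => ⟨(isHypContinuation_hypF_one hθ a hc).1,
        isHypContinuation_hypF_one_add hθ a hc ℓ, (isHypContinuation_euler hθ a hc ℓ).hypF hθ,
        fun x hx => ?_, fun r hr => ?_⟩⟩
    · rw [eval_mul, eval_C, ← poch_mul_hypF_eq_eval_contiguousA hθ a hc, inv_mul_cancel_left₀ hp]
    · refine (natDegree_C_mul_le _ _).trans ?_
      obtain ⟨k, rfl⟩ := Nat.exists_eq_succ_of_ne_zero hℓ.ne'
      exact natDegree_contiguousB_le a c k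
    · have hz : (1 : ℂ) - x ≠ 0 := sub_ne_zero.2 (ne_one_of_mem_cutPlane hx).symm
      have h1 := factorial_mul_hypF_eq hθ a hc ℓ hx
      have h2 := poch_mul_hypF_eq_eval_contiguousA hθ a hc ℓ x
      have h3 : cutPow θ (1 - x) (c - a - 1) * cutPow θ (1 - x) (a + 1 - c) = 1 := by
        rw [← cutPow_add, show c - a - 1 + (a + 1 - c) = 0 by ring, cutPow_zero_right]
      rw [hf, hypF_euler hθ a hc ℓ hx, eval_mul, eval_C]
      field_simp
      linear_combination h1 - hypF θ a 1 c x * h2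
        + ℓ.factorial * (1 - x) ^ ℓ * hypF θ a (1 + ℓ) c x * h3
    · have hA : (contiguousA a c ℓ).eval r = 0 := by
        rw [← poch_mul_hypF_eq_eval_contiguousA hθ a hc, hr, mul_zero]
      rw [hf]
      refine ⟨fun h => ?_, fun h => ?_⟩
      · have hz : (1 : ℂ) - r ≠ 0 := sub_ne_zero.2 (ne_one_of_mem_cutPlane h).symm
        rw [hypF_eq_of_root hθ a hc ℓ hA h, eval_mul, eval_C]
        field_simp
      · rw [hypF_euler_eq_of_root hθ a hc hℓ hA h, eval_mul, eval_C]
        field_simp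
  · intro a b θ hb hab hθ h
    have hc : ∀ n : ℤ, b + 2 ≠ n := fun n h => hb (n - 2) (by push_cast; linear_combination h)
    -- Under this substitution the exceptional case `c = a + 1` becomes `a = 0`.
    have := (hypF_two_eq hθ (a := a + b + 1) (c := b + 2) hc (by
      intro h; exact hab (by linear_combination h))).2
    rw [show b + 2 - 2 = b by ring, show a + b + 1 - 1 = a + b by ring,
      show b + 2 - (a + b + 1) = 1 - a by ring, show a + b + 1 + 1 - (b + 2) = a by ring,
      show b + 2 - 1 = b + 1 by ring] at this
    exact this (h.imp_right fun h => by rw [h]; ring)
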